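/- **Theorem 1.2 (Perron's method for a holomorphic integrand with contour starting at a maximum).** A contour $\mathcal C$ is given by a continuous function $c:[0,1]\to\mathbb C$ that has a continuous derivative except at finitely many points and has finite length $\int_0^1|c'(t)|\,dt$; we write $\int_{\mathcal C}f(z)\,dz=\int_0^1 f(c(t))c'(t)\,dt$. Powers of nonzero complex numbers are principal values, $z^\tau=e^{\tau\log z}$ with $\arg z\in(-\pi,\pi]$. Let $\mathcal C$ be a contour from $c(0)=z_0$ to $c(1)=z_1\ne z_0$ which does not return to its starting point, i.e. $c(t)\neq z_0$ for $0<t\le 1$. Let $\mathcal B$ be a neighborhood of $z_0$, and let $p$ be holomorphic on a domain containing $\mathcal B\cup\mathcal C$ and not constant. Write $$p(z)=p(z_0)-p_0(z-z_0)^\mu(1-\phi(z))\qquad(z\in\mathcal B)$$ with an integer $\mu\ge1$, a number $p_0\in\mathbb C$, $p_0\neq0$, and $\phi$ holomorphic on $\mathcal B$ with $\phi(z_0)=0$. Put $\theta_k=-\frac{\arg p_0}{\mu}+\frac{2\pi k}{\mu}$ for $k\in\mathbb Z$. Suppose that $$\mathrm{Re}\,p(z)<\mathrm{Re}\,p(z_0)\qquad\text{for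 all } z\in\mathcal C,\ z\ne z_0 .$$ Then there is $k\in\mathbb Z$ such that the initial part of $\mathcal C$ lies in the sector of angular width $2\pi/\mu$ about $z_0$ with bisecting angle $\theta_k$; that is, for some $\delta>0$, every $c(t)$ with $0<t<\delta$ has the form $z_0+re^{i\eta}$ with $r>0$ and $|\eta-\theta_k|<\pi/\mu$. For every such $k$, every integer $S\ge0$, every $q$ holomorphic on a domain containing $\mathcal B\cup\mathcal C$, and every bound $K_q$ for $|q|$ on $\mathcal B\cup\mathcal C$, $$\int_{\mathcal C}e^{N p(z)}q(z)\,dz=e^{N p(z_0)}\left(\sum_{s=0}^{S-1}\Gamma\!\left(\frac{s+1}{\mu}\right)\frac{\alpha_s\,e^{2\pi i k(s+1)/\mu}}{N^{(s+1)/\mu}}+O\!\left(\frac{K_q}{N^{(S+1)/\mu}}\right)\right)$$ as $N\to\infty$ through the real numbers, where $$\alpha_s=\frac{1}{\mu\, s!}\,p_0^{-(s+1)/\mu}\,\frac{d^s}{dz^s}\Big\{q(z)\,(1-\phi(z))^{-(s+1)/\mu}\Big\}_{z=z_0}.$$ The implied constant, and the $N_0$ from which on the estimate holds, are independent of $N$,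 of $q$ and of $K_q$. -/

import Mathlib

open Complex Set Filter Topology MeasureTheory

noncomputable section

namespace Perron

/-- A contour, parameterized on `[0, 1]`: `c` is continuous, it has a continuous derivative except
at finitely many parameters, and its length `∫₀¹ |c'(t)| dt` is finite.
Only the values of `c` on `[0, 1]` are relevant. -/
structure IsContour (c : ℝ → ℂ) : Prop where
  continuousOn : ContinuousOn c (Icc 0 1)
  piecewise_C1 : ∃ E : Set ℝ, E.Finite ∧
    ∀ t ∈ Ioo (0 : ℝ) 1 \ E, DifferentiableAt ℝ c t ∧ ContinuousAt (deriv c) t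
  finite_length : IntervalIntegrable (deriv c) volume 0 1

/-- The set of points of the contour. -/
def trace (c : ℝ → ℂ) : Set ℂ := c '' Icc 0 1

/-- The contour integral `∫_C f(z) dz = ∫₀¹ f(c(t)) c'(t) dt`. -/
def contourIntegral (c : ℝ → ℂ) (f : ℂ → ℂ) : ℂ :=
  ∫ t in (0 : ℝ)..1, f (c t) * deriv c t

/-- `f` is holomorphic on some domain (nonempty connected open set) that contains `A`. -/
def HolomorphicOnDomainContaining (f : ℂ → ℂ) (A : Set ℂ) : Prop :=
  ∃ U : Set ℂ, IsOpen U ∧ IsConnected U ∧ A ⊆ U ∧ DifferentiableOn ℂ f U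

/-- The steepest-descent angle `θ_k = -arg(p₀)/μ + 2πk/μ`. -/
def angle (p₀ : ℂ) (μ : ℕ) (k : ℤ) : ℝ :=
  -(arg p₀) / μ + 2 * Real.pi * k / μ

/-- The open sector about `z₀` with bisecting angle `θ` and angular width `w`. -/
def sector (z₀ : ℂ) (θ w : ℝ) : Set ℂ :=
  {z | ∃ r η : ℝ, 0 < r ∧ |η - θ| < w / 2 ∧ z = z₀ + r * exp (η * I)}

/-- The initial part of the contour `c` (without its starting point `z₀`) lies in the sector of
angular width `2π/μ` about `z₀` with bisecting angle `θ_k`. -/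
def StartsInSector (c : ℝ → ℂ) (z₀ p₀ : ℂ) (μ : ℕ) (k : ℤ) : Prop :=
  ∃ δ : ℝ, 0 < δ ∧ ∀ t : ℝ, 0 < t → t < δ → c t ∈ sector z₀ (angle p₀ μ k) (2 * Real.pi / μ)

/-- Perron's coefficient
`α_s = (1/(μ s!)) p₀^{-(s+1)/μ} (d/dz)^s {q(z) (1 - φ(z))^{-(s+1)/μ}}` at `z = z₀`,
all powers being principal values. -/
def coeff (z₀ p₀ : ℂ) (μ : ℕ) (φ q : ℂ → ℂ) (s : ℕ) : ℂ :=
  1 / ((μ : ℂ) * (s.factorial : ℂ)) * p₀ ^ (-((s : ℂ) + 1) / (μ : ℂ)) *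
    iteratedDeriv s (fun z => q z * (1 - φ z) ^ (-((s : ℂ) + 1) / (μ : ℂ))) z₀

end Perron

end

theorem integrableOn_pow_mul_exp_neg_mul_pow {μ : ℕ} (hμ : 1 ≤ μ) (s : ℕ) {N : ℝ} (hN : 0 < N) :
    IntegrableOn (fun x : ℝ => x ^ s * Real.exp (-N * x ^ μ)) (Ioi 0) := by
  have h := integrableOn_rpow_mul_exp_neg_mul_rpow (p := (μ : ℝ)) (s := (s : ℝ)) (b := N)
    (by have : (0 : ℝ) ≤ s := Nat.cast_nonneg s
        linarith) (by exact_mod_cast hμ) hN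
  simpa only [Real.rpow_natCast] using h

theorem integral_pow_mul_exp_neg_mul_pow {μ : ℕ} (hμ : 1 ≤ μ) (s : ℕ) {N : ℝ} (hN : 0 < N) :
    ∫ x in Ioi (0 : ℝ), x ^ s * Real.exp (-N * x ^ μ) =
      Real.Gamma (((s : ℝ) + 1) / μ) / (μ * N ^ (((s : ℝ) + 1) / μ)) := by
  have h := _root_.integral_rpow_mul_exp_neg_mul_rpow (p := (μ : ℝ)) (q := (s : ℝ)) (b := N)
    (by exact_mod_cast hμ) (by have : (0 : ℝ) ≤ s := Nat.cast_nonneg s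
                               linarith) hN
  simp only [Real.rpow_natCast] at h
  rw [h, neg_div, Real.rpow_neg hN.le]
  field_simp

/-- The truncation of the moment integral at `T` costs no more than a multiple of any later
moment. -/
theorem norm_intervalIntegral_pow_mul_exp_sub_le {μ : ℕ} (hμ : 1 ≤ μ) {s S : ℕ} (hs : s ≤ S)
    {T N : ℝ} (hT : 0 < T) (hN : 0 < N) :
    ‖(∫ x in (0 : ℝ)..T, x ^ s * Real.exp (-N * x ^ μ)) -
        Real.Gamma (((s : ℝ) + 1) / μ) / (μ * N ^ (((s : ℝ) + 1) / μ))‖ ≤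
      (T ^ (S - s))⁻¹ *
        (Real.Gamma (((S : ℝ) + 1) / μ) / (μ * N ^ (((S : ℝ) + 1) / μ))) := by
  have hi := integrableOn_pow_mul_exp_neg_mul_pow hμ s hN
  have hI := integrableOn_pow_mul_exp_neg_mul_pow hμ S hN
  have hsub : Ioi T ⊆ Ioi (0 : ℝ) := Ioi_subset_Ioi hT.le
  have hsplit := intervalIntegral.integral_interval_add_Ioi hi (hi.mono_set hsub)
  rw [← integral_pow_mul_exp_neg_mul_pow hμ s hN, ← integral_pow_mul_exp_neg_mul_pow hμ S hN,
    ← hsplit, sub_add_cancel_left, norm_neg, ← integral_const_mul]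
  calc ‖∫ x in Ioi T, x ^ s * Real.exp (-N * x ^ μ)‖
      ≤ ∫ x in Ioi T, (T ^ (S - s))⁻¹ * (x ^ S * Real.exp (-N * x ^ μ)) := by
        refine norm_integral_le_of_norm_le ((hI.mono_set hsub).const_mul _) ?_
        refine (ae_restrict_mem measurableSet_Ioi).mono fun x hx => ?_
        have hx' : T < x := hx
        have hx0 : 0 < x := hT.trans hx'
        rw [Real.norm_of_nonneg (by positivity), ← mul_assoc]
        refine mul_le_mul_of_nonneg_right ?_ (Real.exp_pos _).le
        rw [inv_mul_eq_div, le_div_iff₀ (by positivity), ← Nat.add_sub_of_le hs, pow_add,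
          Nat.add_sub_cancel_left]
        gcongr
    _ ≤ ∫ x in Ioi (0 : ℝ), (T ^ (S - s))⁻¹ * (x ^ S * Real.exp (-N * x ^ μ)) := by
        refine setIntegral_mono_set (hI.const_mul _) ?_ hsub.eventuallyLE
        refine (ae_restrict_mem measurableSet_Ioi).mono fun x hx => ?_
        have hx0 : (0 : ℝ) < x := hx
        simp only [Pi.zero_apply]
        positivity

/-- Watson's lemma on a segment, with a constant that is uniform in the integrand. -/
theorem exists_norm_integral_exp_mul_expansion_le {μ : ℕ} (hμ : 1 ≤ μ) (S : ℕ) {T : ℝ}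
    (hT : 0 < T) :
    ∃ C : ℝ, 0 ≤ C ∧ ∀ (a : ℕ → ℂ) (h : ℝ → ℂ) (M : ℝ), (∀ s < S, ‖a s‖ ≤ M) →
      ContinuousOn h (Icc 0 T) → (∀ x ∈ Icc 0 T, ‖h x‖ ≤ M) → ∀ N : ℝ, 0 < N →
      ‖(∫ x in (0 : ℝ)..T, exp (-(N : ℂ) * (x : ℂ) ^ μ) *
            ((∑ s ∈ Finset.range S, a s * (x : ℂ) ^ s) + (x : ℂ) ^ S * h x)) -
          ∑ s ∈ Finset.range S, a s *
            ((Real.Gamma (((s : ℝ) + 1) / μ) / (μ * N ^ (((s : ℝ) + 1) / μ)) : ℝ) : ℂ)‖ ≤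
        C * (M / N ^ (((S : ℝ) + 1) / μ)) := by
  have hμ0 : (0 : ℝ) < μ := by exact_mod_cast hμ
  have hG : 0 < Real.Gamma (((S : ℝ) + 1) / μ) := Real.Gamma_pos_of_pos (by positivity)
  refine ⟨((∑ s ∈ Finset.range S, (T ^ (S - s))⁻¹) + 1) * (Real.Gamma (((S : ℝ) + 1) / μ) / μ),
    by positivity, ?_⟩
  intro a h M ha hcont hbd N hN
  set J : ℝ := Real.Gamma (((S : ℝ) + 1) / μ) / (μ * N ^ (((S : ℝ) + 1) / μ)) with hJ
  have hJ0 : 0 < J := by positivity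
  have hM : 0 ≤ M := (norm_nonneg _).trans (hbd 0 ⟨le_rfl, hT.le⟩)
  have hcast : ∀ (s : ℕ) (x : ℝ), exp (-(N : ℂ) * (x : ℂ) ^ μ) * (x : ℂ) ^ s =
      ((x ^ s * Real.exp (-N * x ^ μ) : ℝ) : ℂ) := by
    intro s x
    push_cast
    ring
  have hterm : ∀ s, IntervalIntegrable
      (fun x : ℝ => a s * ((x ^ s * Real.exp (-N * x ^ μ) : ℝ) : ℂ)) volume 0 T := fun s =>
    Continuous.intervalIntegrable (by fun_prop) _ _
  have hrem : IntervalIntegrable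
      (fun x : ℝ => ((x ^ S * Real.exp (-N * x ^ μ) : ℝ) : ℂ) * h x) volume 0 T := by
    refine ContinuousOn.intervalIntegrable ?_
    rw [uIcc_of_le hT.le]
    exact (Continuous.continuousOn (by fun_prop)).mul hcont
  have hint : (∫ x in (0 : ℝ)..T, exp (-(N : ℂ) * (x : ℂ) ^ μ) *
        ((∑ s ∈ Finset.range S, a s * (x : ℂ) ^ s) + (x : ℂ) ^ S * h x)) =
      (∑ s ∈ Finset.range S, a s *
        ((∫ x in (0 : ℝ)..T, x ^ s * Real.exp (-N * x ^ μ) : ℝ) : ℂ)) +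
      ∫ x in (0 : ℝ)..T, ((x ^ S * Real.exp (-N * x ^ μ) : ℝ) : ℂ) * h x := by
    have : ∀ x : ℝ, exp (-(N : ℂ) * (x : ℂ) ^ μ) *
        ((∑ s ∈ Finset.range S, a s * (x : ℂ) ^ s) + (x : ℂ) ^ S * h x) =
        (∑ s ∈ Finset.range S, a s * ((x ^ s * Real.exp (-N * x ^ μ) : ℝ) : ℂ)) +
          ((x ^ S * Real.exp (-N * x ^ μ) : ℝ) : ℂ) * h x := by
      intro x
      rw [mul_add, Finset.mul_sum, ← mul_assoc, hcast]
      congr 1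
      refine Finset.sum_congr rfl fun s _ => ?_
      rw [← hcast]
      ring
    simp_rw [this]
    rw [intervalIntegral.integral_add (Continuous.intervalIntegrable (by fun_prop) _ _) hrem,
      intervalIntegral.integral_finsetSum fun s _ => hterm s]
    congr 1
    refine Finset.sum_congr rfl fun s _ => ?_
    rw [intervalIntegral.integral_const_mul, intervalIntegral.integral_ofReal]
  have hremle : ‖∫ x in (0 : ℝ)..T, ((x ^ S * Real.exp (-N * x ^ μ) : ℝ) : ℂ) * h x‖ ≤ M * J := by
    have hI := integrableOn_pow_mul_exp_neg_mul_pow hμ S hN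
    rw [intervalIntegral.integral_of_le hT.le, hJ, ← integral_pow_mul_exp_neg_mul_pow hμ S hN,
      ← integral_const_mul]
    calc _ ≤ ∫ x in Ioc 0 T, M * (x ^ S * Real.exp (-N * x ^ μ)) := by
          refine norm_integral_le_of_norm_le ((hI.mono_set Ioc_subset_Ioi_self).const_mul _) ?_
          refine (ae_restrict_mem measurableSet_Ioc).mono fun x hx => ?_
          have hx0 : 0 < x := hx.1
          rw [norm_mul, norm_real, Real.norm_of_nonneg (by positivity), mul_comm]
          exact mul_le_mul_of_nonneg_right (hbd x ⟨hx.1.le, hx.2⟩) (by positivity)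
      _ ≤ _ := by
          refine setIntegral_mono_set (hI.const_mul _) ?_ Ioc_subset_Ioi_self.eventuallyLE
          refine (ae_restrict_mem measurableSet_Ioi).mono fun x hx => ?_
          have hx0 : (0 : ℝ) < x := hx
          simp only [Pi.zero_apply]
          positivity
  rw [hint, add_sub_right_comm, ← Finset.sum_sub_distrib]
  calc _ ≤ (∑ s ∈ Finset.range S, M * ((T ^ (S - s))⁻¹ * J)) + M * J := by
        refine (norm_add_le _ _).trans (add_le_add ?_ hremle)
        refine norm_sum_le_of_le _ fun s hs => ?_
        have hs' := Finset.mem_range.1 hs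
        rw [← mul_sub, norm_mul, ← ofReal_sub, norm_real]
        exact mul_le_mul (ha s hs')
          (norm_intervalIntegral_pow_mul_exp_sub_le hμ hs'.le hT hN) (norm_nonneg _) hM
    _ = _ := by
        rw [← Finset.mul_sum, ← Finset.sum_mul, hJ]
        field_simp

/-- The remainders of the Taylor expansion at `0`, divided by the power of the variable. -/
theorem iterate_dslope_spec {g : ℂ → ℂ} {ρ M : ℝ} (hρ : 0 < ρ)
    (hg : DifferentiableOn ℂ g (Metric.ball 0 ρ)) (hM : ∀ v ∈ Metric.ball (0 : ℂ) ρ, ‖g v‖ ≤ M)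
    (n : ℕ) :
    DifferentiableOn ℂ ((fun f => dslope f 0)^[n] g) (Metric.ball 0 ρ) ∧
    (∀ v ∈ Metric.ball (0 : ℂ) ρ, ‖(fun f => dslope f 0)^[n] g v‖ ≤ (2 / ρ) ^ n * M) ∧
    ∀ v, g v = (∑ j ∈ Finset.range n, (fun f => dslope f 0)^[j] g 0 * v ^ j) +
        v ^ n * (fun f => dslope f 0)^[n] g v := by
  induction n with
  | zero => exact ⟨hg, by simpa using hM, by simp⟩
  | succ n ih =>
    obtain ⟨hd, hb, he⟩ := ih
    set f := (fun f : ℂ → ℂ => dslope f 0)^[n] g with hf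
    have h0 : (0 : ℂ) ∈ Metric.ball (0 : ℂ) ρ := Metric.mem_ball_self hρ
    simp only [Function.iterate_succ_apply', ← hf]
    refine ⟨(differentiableOn_dslope (Metric.ball_mem_nhds 0 hρ)).2 hd, fun v hv => ?_,
      fun v => ?_⟩
    · have := norm_dslope_le_div_of_mapsTo_ball (R₂ := (2 / ρ) ^ n * M + (2 / ρ) ^ n * M) hd
        (fun w hw => by
          rw [mem_closedBall_iff_norm]
          exact (norm_sub_le _ _).trans (add_le_add (hb w hw) (hb 0 h0))) hv
      refine this.trans (le_of_eq ?_)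
      rw [pow_succ]
      ring
    · rw [he v, Finset.sum_range_succ, add_assoc, ← hf]
      congr 1
      have := sub_smul_dslope f 0 v
      rw [sub_zero, smul_eq_mul] at this
      rw [pow_succ, mul_assoc, this]
      ring

/-- An analytic function with nonvanishing derivative has a holomorphic left inverse on a disc,
with values as close to the base point as desired. -/
theorem exists_local_left_inverse {W : ℂ → ℂ} {z₀ : ℂ} (hW : AnalyticAt ℂ W z₀)
    (hW0 : W z₀ = 0) (hW' : deriv W z₀ ≠ 0) {V : Set ℂ} (hV : V ∈ 𝓝 z₀) :
    ∃ ρ > 0, ∃ m > 0, ∃ ψ : ℂ → ℂ, DifferentiableOn ℂ ψ (Metric.ball 0 ρ) ∧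
      (∀ v ∈ Metric.ball (0 : ℂ) ρ, ψ v ∈ V ∧ AnalyticAt ℂ W (ψ v) ∧ m ≤ ‖deriv W (ψ v)‖) ∧
      ∀ᶠ z in 𝓝 z₀, W z ∈ Metric.ball 0 ρ ∧ ψ (W z) = z := by
  set ψ := hW.hasStrictDerivAt.localInverse _ _ _ hW' with hψ
  have hleft : ∀ᶠ z in 𝓝 z₀, ψ (W z) = z := hW.hasStrictDerivAt.eventually_left_inverse hW'
  have hψa : AnalyticAt ℂ ψ 0 := hW0 ▸ hW.analyticAt_localInverse hW'
  have hψ0 : ψ 0 = z₀ := hW0 ▸ hleft.self_of_nhds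
  have hm : 0 < ‖deriv W z₀‖ / 2 := by positivity
  have hz : ∀ᶠ z in 𝓝 z₀, z ∈ V ∧ AnalyticAt ℂ W z ∧ ‖deriv W z₀‖ / 2 ≤ ‖deriv W z‖ := by
    refine (show ∀ᶠ z in 𝓝 z₀, z ∈ V from hV).and (hW.eventually_analyticAt.and ?_)
    have := hW.deriv.continuousAt.norm.eventually_const_lt (half_lt_self (norm_pos_iff.2 hW'))
    exact this.mono fun _ h => h.le
  have hv : ∀ᶠ v in 𝓝 (0 : ℂ), ψ v ∈ V ∧ AnalyticAt ℂ W (ψ v) ∧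
      ‖deriv W z₀‖ / 2 ≤ ‖deriv W (ψ v)‖ :=
    (show Tendsto ψ (𝓝 0) (𝓝 z₀) from hψ0 ▸ hψa.continuousAt.tendsto).eventually hz
  obtain ⟨ρ, hρ, h⟩ := Metric.eventually_nhds_iff_ball.1 (hv.and hψa.eventually_analyticAt)
  refine ⟨ρ, hρ, _, hm, ψ, fun v hv => (h v hv).2.differentiableAt.differentiableWithinAt,
    fun v hv => (h v hv).1, ?_⟩
  have hWt : Tendsto W (𝓝 z₀) (𝓝 0) := hW0 ▸ hW.continuousAt.tendsto
  exact (hWt.eventually (Metric.ball_mem_nhds 0 hρ)).and hleft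

/-- Lagrange inversion: the coefficients of an expansion of `q dz` in powers of the local
coordinate `W z = (z - z₀) * U z`. -/
theorem iteratedDeriv_mul_inv_pow_of_expansion {z₀ : ℂ} {U q k : ℂ → ℂ} {a : ℕ → ℂ} {s : ℕ}
    (hU : AnalyticAt ℂ U z₀) (hU0 : U z₀ ≠ 0) (hq : AnalyticAt ℂ q z₀) (hk : AnalyticAt ℂ k z₀)
    (h : ∀ᶠ z in 𝓝 z₀, q z = (∑ j ∈ Finset.range (s + 1), a j * ((z - z₀) * U z) ^ j) *
      deriv (fun z => (z - z₀) * U z) z + ((z - z₀) * U z) ^ (s + 1) * k z) :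
    iteratedDeriv s (fun z => q z * (U z)⁻¹ ^ (s + 1)) z₀ = s.factorial * a s := by
  obtain ⟨ε, hε, hev⟩ := Metric.eventually_nhds_iff_ball.1
    ((((h.and hU.eventually_analyticAt).and hq.eventually_analyticAt).and
      hk.eventually_analyticAt).and (hU.continuousAt.eventually_ne hU0))
  have hR : 0 < ε / 2 := by positivity
  have hsub : Metric.closedBall z₀ (ε / 2) ⊆ Metric.ball z₀ ε :=
    Metric.closedBall_subset_ball (half_lt_self hε)
  set f : ℂ → ℂ := fun z => q z * (U z)⁻¹ ^ (s + 1) with hf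
  have hfd : DifferentiableOn ℂ f (Metric.closedBall z₀ (ε / 2)) := by
    intro z hz
    obtain ⟨⟨⟨⟨-, hUz⟩, hqz⟩, -⟩, hU0z⟩ := hev z (hsub hz)
    exact (hqz.differentiableAt.mul
      ((hUz.differentiableAt.inv hU0z).pow (s + 1))).differentiableWithinAt
  have hcauchy := hfd.circleIntegral_one_div_sub_center_pow_smul hR s
  obtain ⟨P, hP⟩ : IsExactOn (fun z => a s * (deriv U z / U z) + k z) (Metric.ball z₀ ε) := by
    refine DifferentiableOn.isExactOn_ball fun z hz => ?_
    obtain ⟨⟨⟨⟨-, hUz⟩, -⟩, hkz⟩, hU0z⟩ := hev z hz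
    exact ((((hUz.deriv.differentiableAt).div hUz.differentiableAt hU0z).const_mul _).add
      hkz.differentiableAt).differentiableWithinAt
  have hne : ∀ z ∈ Metric.sphere z₀ (ε / 2), z - z₀ ≠ 0 := fun z hz =>
    sub_ne_zero.2 (Metric.ne_of_mem_sphere hz hR.ne')
  have hprim : ∮ z in C(z₀, ε / 2), ((1 / (z - z₀) ^ (s + 1)) • f z - a s * (z - z₀)⁻¹) = 0 := by
    refine circleIntegral.integral_eq_zero_of_hasDerivWithinAt hR.le
      (f := fun z => (∑ j ∈ Finset.range s,
        a j * (-(1 / ((s - j : ℕ) : ℂ)) * (((z - z₀) * U z) ^ (s - j))⁻¹)) + P z)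
      fun z hz => HasDerivAt.hasDerivWithinAt ?_
    have hzb := hsub (Metric.sphere_subset_closedBall hz)
    obtain ⟨⟨⟨⟨hqe, hUz⟩, -⟩, -⟩, hU0z⟩ := hev z hzb
    have hz0 := hne z hz
    have hWd : HasDerivAt (fun z => (z - z₀) * U z) (U z + (z - z₀) * deriv U z) z := by
      simpa using ((hasDerivAt_id' z).sub_const z₀).fun_mul hUz.differentiableAt.hasDerivAt
    have hW0 : (z - z₀) * U z ≠ 0 := mul_ne_zero hz0 hU0z
    have hsum : HasDerivAt (fun z => ∑ j ∈ Finset.range s,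
        a j * (-(1 / ((s - j : ℕ) : ℂ)) * (((z - z₀) * U z) ^ (s - j))⁻¹))
        (∑ j ∈ Finset.range s, a j * (((z - z₀) * U z) ^ j / ((z - z₀) * U z) ^ (s + 1) *
          (U z + (z - z₀) * deriv U z))) z := by
      refine HasDerivAt.fun_sum fun j hj => HasDerivAt.const_mul _ ?_
      obtain ⟨n, rfl⟩ := Nat.exists_eq_add_of_lt (Finset.mem_range.1 hj)
      have hn : j + n + 1 - j = n + 1 := by omega
      rw [hn]
      have hd := ((hWd.fun_pow (n + 1)).fun_inv (pow_ne_zero _ hW0)).const_mul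
        (-(1 / ((n + 1 : ℕ) : ℂ)))
      refine hd.congr_deriv ?_
      have hn0 : ((n + 1 : ℕ) : ℂ) ≠ 0 := Nat.cast_ne_zero.2 n.succ_ne_zero
      generalize (z - z₀) * U z = w at hW0
      generalize U z + (z - z₀) * deriv U z = w'
      rw [Nat.add_sub_cancel]
      field_simp
      ring
    refine (hsum.add (hP z hzb)).congr_deriv ?_
    rw [smul_eq_mul, hf]
    simp only
    rw [hqe, hWd.deriv, Finset.sum_range_succ]
    have hmul : ∑ j ∈ Finset.range s, a j * (((z - z₀) * U z) ^ j / ((z - z₀) * U z) ^ (s + 1) *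
          (U z + (z - z₀) * deriv U z)) =
        (∑ j ∈ Finset.range s, a j * ((z - z₀) * U z) ^ j) *
          ((U z + (z - z₀) * deriv U z) / ((z - z₀) * U z) ^ (s + 1)) := by
      rw [Finset.sum_mul]
      refine Finset.sum_congr rfl fun j _ => ?_
      ring
    rw [hmul]
    generalize (∑ j ∈ Finset.range s, a j * ((z - z₀) * U z) ^ j) = A
    simp only [inv_pow, mul_pow, pow_succ]
    field_simp
    ring
  have hci1 : CircleIntegrable (fun z => (1 / (z - z₀) ^ (s + 1)) • f z) z₀ (ε / 2) := by
    refine ContinuousOn.circleIntegrable hR.le ?_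
    refine ContinuousOn.smul (continuousOn_const.div (by fun_prop)
      fun z hz => pow_ne_zero _ (hne z hz)) ?_
    exact hfd.continuousOn.mono Metric.sphere_subset_closedBall
  have hci2 : CircleIntegrable (fun z => a s * (z - z₀)⁻¹) z₀ (ε / 2) := by
    refine ContinuousOn.circleIntegrable hR.le ?_
    exact continuousOn_const.mul (ContinuousOn.inv₀ (by fun_prop) hne)
  rw [circleIntegral.integral_sub hci1 hci2, hcauchy, circleIntegral.integral_const_mul,
    circleIntegral.integral_sub_center_inv z₀ hR.ne', sub_eq_zero, smul_eq_mul] at hprim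
  have h2 : (2 * (Real.pi : ℂ) * I) ≠ 0 := two_pi_I_ne_zero
  have hfac : (s.factorial : ℂ) ≠ 0 := Nat.cast_ne_zero.2 s.factorial_ne_zero
  refine mul_left_cancel₀ h2 ?_
  rw [div_mul_eq_mul_div, div_eq_iff hfac] at hprim
  rw [hprim]
  ring

namespace Perron.IsContour

variable {c : ℝ → ℂ} {a b : ℝ}

theorem intervalIntegrable_comp_mul_deriv (hc : Perron.IsContour c) (ha : 0 ≤ a) (hab : a ≤ b)
    (hb : b ≤ 1) {f : ℂ → ℂ} (hf : ContinuousOn (fun t => f (c t)) (Icc a b)) :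
    IntervalIntegrable (fun t => f (c t) * deriv c t) volume a b := by
  refine IntervalIntegrable.continuousOn_mul (hc.finite_length.mono_set ?_)
    (by rwa [uIcc_of_le hab])
  rw [uIcc_of_le hab, uIcc_of_le zero_le_one]
  exact Icc_subset_Icc ha hb

theorem integral_deriv_comp (hc : Perron.IsContour c) (ha : 0 ≤ a) (hab : a ≤ b) (hb : b ≤ 1)
    {F f : ℂ → ℂ} (hF : ∀ t ∈ Icc a b, HasDerivAt F (f (c t)) (c t))
    (hf : ContinuousOn (fun t => f (c t)) (Icc a b)) :
    ∫ t in a..b, f (c t) * deriv c t = F (c b) - F (c a) := by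
  obtain ⟨E, hE, hd⟩ := hc.piecewise_C1
  refine integral_eq_of_hasDerivAt_off_countable_of_le (fun t => F (c t)) _ hab hE.countable
    (fun t ht => ?_) (fun t ht => ?_) (hc.intervalIntegrable_comp_mul_deriv ha hab hb hf)
  · exact (hF t ht).continuousAt.comp_continuousWithinAt
      ((hc.continuousOn.mono (Icc_subset_Icc ha hb)) t ht)
  · have := (hd t ⟨⟨ha.trans_lt ht.1.1, ht.1.2.trans_le hb⟩, ht.2⟩).1
    exact (hF t (Ioo_subset_Icc_self ht.1)).comp t this.hasDerivAt

end Perron.IsContour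

theorem exists_exp_neg_mul_le_one_div_rpow (β : ℝ) {κ : ℝ} (hκ : 0 < κ) :
    ∃ N₀ : ℝ, 0 < N₀ ∧ ∀ N : ℝ, N₀ ≤ N → Real.exp (-κ * N) ≤ 1 / N ^ β := by
  have h := (tendsto_rpow_mul_exp_neg_mul_atTop_nhds_zero β κ hκ).eventually_le_const one_pos
  obtain ⟨N₁, h₁⟩ := eventually_atTop.1 h
  refine ⟨max N₁ 1, by positivity, fun N hN => ?_⟩
  have hN0 : 0 < N := one_pos.trans_le ((le_max_right _ _).trans hN)
  rw [le_div_iff₀ (Real.rpow_pos_of_pos hN0 β), mul_comm]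
  exact h₁ N ((le_max_left _ _).trans hN)

/-- Asymptotics of a primitive of `exp (-N v ^ μ) * g v` between the origin and a point with
argument below `π / (2μ)`. -/
theorem exists_norm_primitive_sub_le {μ : ℕ} (hμ : 1 ≤ μ) (S : ℕ) {ρ r α : ℝ} (hr : 0 < r)
    (hrρ : r < ρ) (hα : |μ * α| < Real.pi / 2) :
    ∃ C N₀ : ℝ, 0 < N₀ ∧ ∀ (g : ℂ → ℂ) (M : ℝ), DifferentiableOn ℂ g (Metric.ball 0 ρ) →
      (∀ v ∈ Metric.ball (0 : ℂ) ρ, ‖g v‖ ≤ M) → ∀ N : ℝ, N₀ ≤ N → ∀ H : ℂ → ℂ,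
      (∀ v ∈ Metric.ball (0 : ℂ) ρ, HasDerivAt H (exp (-(N : ℂ) * v ^ μ) * g v) v) →
      ‖H (r * exp (α * I)) - H 0 - ∑ s ∈ Finset.range S, (fun f => dslope f 0)^[s] g 0 *
          ((Real.Gamma (((s : ℝ) + 1) / μ) / (μ * N ^ (((s : ℝ) + 1) / μ)) : ℝ) : ℂ)‖ ≤
        C * (M / N ^ (((S : ℝ) + 1) / μ)) := by
  have hρ : 0 < ρ := hr.trans hrρ
  obtain ⟨C, hC, hwatson⟩ := exists_norm_integral_exp_mul_expansion_le hμ S hr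
  have hcos : 0 < Real.cos (μ * α) := Real.cos_pos_of_mem_Ioo (abs_lt.1 hα)
  set κ : ℝ := r ^ μ * Real.cos (μ * α) with hκdef
  have hκ : 0 < κ := by positivity
  obtain ⟨N₀, hN₀, hexp⟩ := exists_exp_neg_mul_le_one_div_rpow (((S : ℝ) + 1) / μ) hκ
  set K : ℝ := ∑ s ∈ Finset.range (S + 1), (2 / ρ) ^ s with hK
  have hKle : ∀ s ≤ S, (2 / ρ) ^ s ≤ K := fun s hs =>
    Finset.single_le_sum (f := fun s : ℕ => (2 / ρ) ^ s) (fun i _ => by positivity)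
      (Finset.mem_range.2 (Nat.lt_succ_of_le hs))
  refine ⟨C * K + r * |α|, N₀, hN₀, fun g M hg hM N hN H hH => ?_⟩
  have hN0 : 0 < N := hN₀.trans_le hN
  have hM0 : 0 ≤ M := (norm_nonneg _).trans (hM 0 (Metric.mem_ball_self hρ))
  have hreal : ∀ x ∈ Icc 0 r, (x : ℂ) ∈ Metric.ball (0 : ℂ) ρ := fun x hx => by
    rw [mem_ball_zero_iff, norm_real, Real.norm_of_nonneg hx.1]
    exact hx.2.trans_lt hrρ
  have hseg : H r - H 0 = ∫ x in (0 : ℝ)..r, exp (-(N : ℂ) * (x : ℂ) ^ μ) *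
      ((∑ s ∈ Finset.range S, (fun f => dslope f 0)^[s] g 0 * (x : ℂ) ^ s) +
        (x : ℂ) ^ S * (fun f => dslope f 0)^[S] g x) := by
    simp_rw [← (iterate_dslope_spec hρ hg hM S).2.2]
    have := intervalIntegral.integral_eq_sub_of_hasDerivAt (a := 0) (b := r)
      (f := fun x : ℝ => H x) (f' := fun x : ℝ => exp (-(N : ℂ) * (x : ℂ) ^ μ) * g x)
      (fun x hx => (hH x (hreal x (by rwa [uIcc_of_le hr.le] at hx))).comp_ofReal)
      (by
        refine ContinuousOn.intervalIntegrable ?_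
        rw [uIcc_of_le hr.le]
        refine ContinuousOn.mul (Continuous.continuousOn (by fun_prop)) ?_
        exact hg.continuousOn.comp continuous_ofReal.continuousOn hreal)
    rw [this, ofReal_zero]
  have hmain := hwatson (fun s => (fun f => dslope f 0)^[s] g 0)
    (fun x => (fun f => dslope f 0)^[S] g x) (K * M)
    (fun s hs => ((iterate_dslope_spec hρ hg hM s).2.1 0 (Metric.mem_ball_self hρ)).trans
      (mul_le_mul_of_nonneg_right (hKle s hs.le) hM0))
    ((iterate_dslope_spec hρ hg hM S).1.continuousOn.comp continuous_ofReal.continuousOn hreal)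
    (fun x hx => ((iterate_dslope_spec hρ hg hM S).2.1 x (hreal x hx)).trans
      (mul_le_mul_of_nonneg_right (hKle S le_rfl) hM0)) N hN0
  rw [← hseg] at hmain
  have harc : ‖H (r * exp (α * I)) - H r‖ ≤ Real.exp (-κ * N) * M * (r * |α|) := by
    have hball : ∀ t : ℝ, (r : ℂ) * exp ((t * α : ℝ) * I) ∈ Metric.ball (0 : ℂ) ρ := fun t => by
      rw [mem_ball_zero_iff, norm_mul, norm_exp_ofReal_mul_I, norm_real,
        Real.norm_of_nonneg hr.le, mul_one]
      exact hrρ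
    have hd : ∀ t : ℝ, HasDerivAt (fun t : ℝ => H (r * exp ((t * α : ℝ) * I)))
        (exp (-(N : ℂ) * (r * exp ((t * α : ℝ) * I)) ^ μ) * g (r * exp ((t * α : ℝ) * I)) *
          (r * (exp ((t * α : ℝ) * I) * (α * I)))) t := fun t => by
      have hin : HasDerivAt (fun t : ℝ => ((t * α : ℝ) : ℂ) * I) (α * I) t := by
        have := ((hasDerivAt_id t).mul_const α).ofReal_comp.mul_const I
        simpa using this
      exact (hH _ (hball t)).comp t (hin.cexp.const_mul (r : ℂ))
    have := norm_image_sub_le_of_norm_deriv_le_segment_01'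
      (f := fun t : ℝ => H (r * exp ((t * α : ℝ) * I)))
      (C := Real.exp (-κ * N) * M * (r * |α|))
      (fun t _ => (hd t).hasDerivWithinAt) (fun t ht => ?_)
    · simpa using this
    · have hre : (-(N : ℂ) * (r * exp ((t * α : ℝ) * I)) ^ μ).re =
          -(r ^ μ * Real.cos (μ * (t * α))) * N := by
        have : -(N : ℂ) * (r * exp ((t * α : ℝ) * I)) ^ μ =
            ((-(r ^ μ * N) : ℝ) : ℂ) * exp ((μ * (t * α) : ℝ) * I) := by
          rw [mul_pow, ← exp_nat_mul]
          push_cast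
          rw [← mul_assoc (μ : ℂ)]
          ring
        rw [this, re_ofReal_mul, exp_ofReal_mul_I_re]
        ring
      have hcosle : Real.cos (μ * α) ≤ Real.cos (μ * (t * α)) := by
        rw [← Real.cos_abs (μ * α), ← Real.cos_abs (μ * (t * α))]
        refine Real.cos_le_cos_of_nonneg_of_le_pi (abs_nonneg _)
          (hα.le.trans (by linarith [Real.pi_pos])) ?_
        rw [mul_left_comm, abs_mul t, abs_of_nonneg ht.1]
        exact mul_le_of_le_one_left (abs_nonneg _) ht.2.le
      rw [norm_mul, norm_mul, norm_exp, hre, norm_mul, norm_mul, norm_mul, norm_real, norm_real,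
        norm_exp_ofReal_mul_I, norm_I, mul_one, one_mul, Real.norm_of_nonneg hr.le,
        Real.norm_eq_abs]
      have hexple : Real.exp (-(r ^ μ * Real.cos (μ * (t * α))) * N) ≤ Real.exp (-κ * N) := by
        rw [hκdef]
        gcongr
      exact mul_le_mul_of_nonneg_right
        (mul_le_mul hexple (hM _ (hball t)) (norm_nonneg _) (Real.exp_pos _).le) (by positivity)
  have harc' : ‖H (r * exp (α * I)) - H r‖ ≤ r * |α| * (M / N ^ (((S : ℝ) + 1) / μ)) := by
    refine harc.trans ?_
    calc _ ≤ 1 / N ^ (((S : ℝ) + 1) / μ) * M * (r * |α|) := by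
          gcongr
          exact hexp N hN
      _ = _ := by ring
  calc _ = ‖(H (r * exp (α * I)) - H r) + (H r - H 0 - ∑ s ∈ Finset.range S,
        (fun f => dslope f 0)^[s] g 0 *
          ((Real.Gamma (((s : ℝ) + 1) / μ) / (μ * N ^ (((s : ℝ) + 1) / μ)) : ℝ) : ℂ))‖ := by
        congr 1
        ring
    _ ≤ r * |α| * (M / N ^ (((S : ℝ) + 1) / μ)) + C * (K * M / N ^ (((S : ℝ) + 1) / μ)) :=
        (norm_add_le _ _).trans (add_le_add harc' hmain)
    _ = _ := by ring

theorem cpow_ofReal_eq_polar (x : ℂ) (y : ℝ) :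
    x ^ (y : ℂ) = ((‖x‖ ^ y : ℝ) : ℂ) * exp ((arg x * y : ℝ) * I) := by
  rw [Complex.cpow_ofReal, exp_mul_I, ofReal_cos, ofReal_sin]

theorem mem_slitPlane_of_re_mul_pos {Q x : ℂ} (hx : 0 < x.re) (hQ : 0 < (Q * x).re) :
    Q ∈ slitPlane := by
  by_contra h
  rw [mem_slitPlane_iff, not_or, not_lt, not_not] at h
  rw [mul_re, h.2, zero_mul, sub_zero] at hQ
  exact hQ.not_ge (mul_nonpos_of_nonpos_of_nonneg h.1 hx.le)

namespace Perron

variable {p₀ : ℂ} {μ : ℕ}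

/-- The root of `p₀⁻¹` of order `μ` whose argument is the angle `θ_k`. -/
noncomputable def invRoot (p₀ : ℂ) (μ : ℕ) (k : ℤ) : ℂ :=
  p₀ ^ (-(1 : ℂ) / μ) * exp (2 * Real.pi * I * k / μ)

theorem invRoot_eq_polar (p₀ : ℂ) (μ : ℕ) (k : ℤ) :
    invRoot p₀ μ k =
      ((‖p₀‖ ^ (-(1 : ℝ) / μ) : ℝ) : ℂ) * exp ((angle p₀ μ k : ℝ) * I) := by
  have h := cpow_ofReal_eq_polar p₀ (-(1 : ℝ) / μ)
  push_cast at h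
  rw [invRoot, h, mul_assoc, ← exp_add, angle]
  push_cast
  congr 2
  ring

theorem invRoot_ne_zero (hp₀ : p₀ ≠ 0) (μ : ℕ) (k : ℤ) : invRoot p₀ μ k ≠ 0 :=
  mul_ne_zero (by simp [cpow_eq_zero_iff, hp₀]) (exp_ne_zero _)

theorem invRoot_pow (hμ : 1 ≤ μ) (p₀ : ℂ) (k : ℤ) : invRoot p₀ μ k ^ μ = p₀⁻¹ := by
  have hμ0 : (μ : ℂ) ≠ 0 := Nat.cast_ne_zero.2 (by omega)
  rw [invRoot, mul_pow, ← cpow_nat_mul, ← exp_nat_mul, mul_div_cancel₀ _ hμ0,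
    mul_div_cancel₀ _ hμ0, cpow_neg_one, mul_comm (2 * (Real.pi : ℂ) * I), exp_int_mul_two_pi_mul_I,
    mul_one]

/-- The function `z ↦ (1 - φ z) ^ (1 / μ)`, normalized such that `(z - z₀) * localFactor` is the
`μ`-th root of `p z₀ - p z` that is positive in the direction `θ_k`. -/
noncomputable def localFactor (p₀ : ℂ) (μ : ℕ) (k : ℤ) (φ : ℂ → ℂ) (z : ℂ) : ℂ :=
  (1 - φ z) ^ ((μ : ℂ)⁻¹) * (invRoot p₀ μ k)⁻¹

theorem mul_localFactor_pow (hμ : 1 ≤ μ) (p₀ : ℂ) (k : ℤ) (φ : ℂ → ℂ) (ζ z : ℂ) :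
    (ζ * localFactor p₀ μ k φ z) ^ μ = p₀ * ζ ^ μ * (1 - φ z) := by
  rw [localFactor, mul_pow, mul_pow, inv_pow, invRoot_pow hμ, inv_inv,
    cpow_nat_inv_pow _ (by omega)]
  ring

theorem exists_polar_of_mem_sector (hμ : 1 ≤ μ) (hp₀ : p₀ ≠ 0) {k : ℤ} {φ : ℂ → ℂ} {z z₀ : ℂ}
    (hz : z ∈ sector z₀ (angle p₀ μ k) (2 * Real.pi / μ)) (hφ : 0 < (1 - φ z).re)
    (hre : 0 < (p₀ * (z - z₀) ^ μ * (1 - φ z)).re) :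
    ∃ r α : ℝ, 0 < r ∧ |μ * α| < Real.pi / 2 ∧
      (z - z₀) * localFactor p₀ μ k φ z = r * exp (α * I) := by
  obtain ⟨r₀, η, hr₀, hη, hzeq⟩ := hz
  have hμ0 : (0 : ℝ) < μ := by exact_mod_cast hμ
  have hx : 1 - φ z ≠ 0 := fun h => by simp [h] at hφ
  set α : ℝ := η - angle p₀ μ k + arg (1 - φ z) * (μ : ℝ)⁻¹ with hα
  set r : ℝ := r₀ * ‖1 - φ z‖ ^ ((μ : ℝ)⁻¹) * (‖p₀‖ ^ (-(1 : ℝ) / μ))⁻¹ with hr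
  have hr0 : 0 < r := by
    have := norm_pos_iff.2 hx
    have := norm_pos_iff.2 hp₀
    positivity
  have heq : (z - z₀) * localFactor p₀ μ k φ z = r * exp (α * I) := by
    have hpol := cpow_ofReal_eq_polar (1 - φ z) ((μ : ℝ)⁻¹)
    rw [ofReal_inv, ofReal_natCast] at hpol
    have hexp : exp (α * I) = exp (η * I) * exp ((arg (1 - φ z) * (μ : ℝ)⁻¹ : ℝ) * I) *
        (exp ((angle p₀ μ k : ℝ) * I))⁻¹ := by
      rw [← exp_neg, ← exp_add, ← exp_add, hα]
      congr 1
      push_cast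
      ring
    rw [localFactor, invRoot_eq_polar p₀, hpol, hexp, sub_eq_iff_eq_add'.2 hzeq, hr]
    simp only [mul_inv, ofReal_mul, ofReal_inv]
    ring
  refine ⟨r, α, hr0, ?_, heq⟩
  rw [← mul_localFactor_pow hμ p₀ k φ, heq, mul_pow, ← exp_nat_mul, ← mul_assoc, ← ofReal_pow,
    ← ofReal_natCast, ← ofReal_mul, re_ofReal_mul, exp_ofReal_mul_I_re] at hre
  have hcos : 0 < Real.cos (μ * α) := pos_of_mul_pos_right hre (by positivity)
  have harg : |arg (1 - φ z)| < Real.pi / 2 := abs_arg_lt_pi_div_two_iff.2 (Or.inl hφ)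
  have hlt : |μ * α| < Real.pi + Real.pi / 2 := by
    have h1 : μ * α = μ * (η - angle p₀ μ k) + arg (1 - φ z) := by
      rw [hα]
      field_simp
    have h2 : |μ * (η - angle p₀ μ k)| < Real.pi := by
      rw [abs_mul, abs_of_pos hμ0, mul_comm, ← lt_div_iff₀ hμ0]
      refine hη.trans_eq ?_
      ring
    rw [h1]
    exact (abs_add_le _ _).trans_lt (add_lt_add h2 harg)
  by_contra! h
  rw [← Real.cos_abs] at hcos
  exact hcos.not_ge (Real.cos_nonpos_of_pi_div_two_le_of_le h hlt.le)

theorem exists_startsInSector (hμ : 1 ≤ μ) (hp₀ : p₀ ≠ 0) {c : ℝ → ℂ} {z₀ : ℂ} {δ : ℝ}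
    (hδ : 0 < δ) (hc : ContinuousOn c (Ioo 0 δ))
    (h : ∀ t ∈ Ioo 0 δ, p₀ * (c t - z₀) ^ μ ∈ slitPlane) : ∃ k : ℤ, StartsInSector c z₀ p₀ μ k := by
  have hμn : μ ≠ 0 := by omega
  have hμ0 : (0 : ℝ) < μ := by exact_mod_cast hμ
  set Q : ℝ → ℂ := fun t => p₀ * (c t - z₀) ^ μ with hQ
  set κ : ℝ → ℂ := fun t => (c t - z₀) / invRoot p₀ μ 0 / Q t ^ ((μ : ℂ)⁻¹) with hκ
  have hQ0 : ∀ t ∈ Ioo 0 δ, Q t ≠ 0 := fun t ht => slitPlane_ne_zero (h t ht)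
  have hQr : ∀ t ∈ Ioo 0 δ, Q t ^ ((μ : ℂ)⁻¹) ≠ 0 := fun t ht => by
    simp [cpow_eq_zero_iff, hQ0 t ht]
  have hQc : ContinuousOn Q (Ioo 0 δ) := by fun_prop
  have hκc : ContinuousOn κ (Ioo 0 δ) :=
    ((hc.sub continuousOn_const).div_const _).div (hQc.cpow continuousOn_const h) hQr
  have hκ1 : ∀ t ∈ Ioo 0 δ, κ t ^ μ = 1 := fun t ht => by
    simp only [hκ, div_pow, invRoot_pow hμ, cpow_nat_inv_pow _ hμn]
    rw [div_inv_eq_mul, mul_comm]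
    exact div_self (hQ0 t ht)
  have hfin : {x : ℂ | x ^ μ = 1}.Finite := by
    refine (Polynomial.nthRoots μ (1 : ℂ)).toFinset.finite_toSet.subset fun x hx => ?_
    simpa [Polynomial.mem_nthRoots (Nat.pos_of_ne_zero hμn)] using hx
  obtain ⟨ω, hω, hκω⟩ := isPreconnected_Ioo.eqOn_const_of_mapsTo hfin.isDiscrete hκc hκ1
    ⟨1, one_pow μ⟩
  have : NeZero μ := ⟨hμn⟩
  obtain ⟨i, -, hi⟩ := (isPrimitiveRoot_exp μ hμn).eq_pow_of_pow_eq_one hω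
  refine ⟨i, δ, hδ, fun t h0 ht => ⟨‖p₀‖ ^ (-(1 : ℝ) / μ) * ‖Q t‖ ^ ((μ : ℝ)⁻¹),
    angle p₀ μ i + arg (Q t) * (μ : ℝ)⁻¹, ?_, ?_, ?_⟩⟩
  · have := norm_pos_iff.2 hp₀
    have := norm_pos_iff.2 (hQ0 t ⟨h0, ht⟩)
    positivity
  · have harg : |arg (Q t)| < Real.pi := by
      refine lt_of_le_of_ne (abs_arg_le_pi _) fun hpi => ?_
      rcases (mem_slitPlane_iff_arg.1 (h t ⟨h0, ht⟩)).1, eq_or_eq_neg_of_abs_eq hpi with ⟨hne, heq | heq⟩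
      · exact hne heq
      · exact absurd heq (neg_pi_lt_arg _).ne'
    rw [add_sub_cancel_left, abs_mul, abs_inv, abs_of_pos hμ0, ← div_eq_mul_inv, mul_div_assoc,
      mul_div_cancel_left₀ _ two_ne_zero]
    gcongr
  · have hk : κ t = ω := hκω ⟨h0, ht⟩
    have hb := invRoot_ne_zero hp₀ μ 0
    have hstep : c t - z₀ = invRoot p₀ μ i * Q t ^ ((μ : ℂ)⁻¹) := by
      have hbi : invRoot p₀ μ i = invRoot p₀ μ 0 * ω := by
        rw [invRoot, invRoot, ← hi, ← exp_nat_mul]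
        simp only [Int.cast_zero, mul_zero, zero_div, exp_zero, mul_one, Int.cast_natCast]
        congr 2
        ring
      rw [hbi, ← hk, hκ]
      field_simp [hQr t ⟨h0, ht⟩]
    have hpol := cpow_ofReal_eq_polar (Q t) ((μ : ℝ)⁻¹)
    rw [ofReal_inv, ofReal_natCast] at hpol
    rw [invRoot_eq_polar p₀, hpol] at hstep
    rw [← sub_eq_iff_eq_add', hstep, ofReal_add, add_mul, exp_add]
    simp only [ofReal_mul]
    ring

theorem coeff_mul_exp (z₀ p₀ : ℂ) (μ : ℕ) (k : ℤ) (φ q : ℂ → ℂ) (s : ℕ) :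
    coeff z₀ p₀ μ φ q s * exp (2 * (Real.pi : ℂ) * I * (k : ℂ) * ((s : ℂ) + 1) / (μ : ℂ)) =
      1 / ((μ : ℂ) * (s.factorial : ℂ)) *
        iteratedDeriv s (fun z => q z * (localFactor p₀ μ k φ z)⁻¹ ^ (s + 1)) z₀ := by
  have hfun : (fun z => q z * (localFactor p₀ μ k φ z)⁻¹ ^ (s + 1)) = fun z =>
      invRoot p₀ μ k ^ (s + 1) * (q z * (1 - φ z) ^ (-((s : ℂ) + 1) / (μ : ℂ))) := by
    funext z
    have : -((s : ℂ) + 1) / μ = ((s + 1 : ℕ) : ℂ) * -((μ : ℂ)⁻¹) := by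
      push_cast
      ring
    rw [this, cpow_nat_mul, cpow_neg, localFactor, mul_inv, inv_inv, mul_pow]
    ring
  have hroot : invRoot p₀ μ k ^ (s + 1) = p₀ ^ (-((s : ℂ) + 1) / (μ : ℂ)) *
      exp (2 * (Real.pi : ℂ) * I * (k : ℂ) * ((s : ℂ) + 1) / (μ : ℂ)) := by
    rw [invRoot, mul_pow, ← cpow_nat_mul, ← exp_nat_mul]
    congr 2 <;> push_cast <;> ring
  rw [hfun, iteratedDeriv_const_mul_field, hroot, coeff]
  ring

theorem IsContour.exists_initial {c : ℝ → ℂ} (hc : IsContour c) {P : ℂ → Prop}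
    (hP : ∀ᶠ z in 𝓝 (c 0), P z) : ∃ τ : ℝ, 0 < τ ∧ τ ≤ 1 ∧ ∀ t ∈ Icc 0 τ, P (c t) := by
  have h := (hc.continuousOn 0 ⟨le_rfl, zero_le_one⟩).eventually hP
  obtain ⟨ε, hε, hε'⟩ := Metric.mem_nhdsWithin_iff.1 h
  refine ⟨min (ε / 2) 1, by positivity, min_le_right _ _, fun t ht => hε' ⟨?_, ht.1,
    ht.2.trans (min_le_right _ _)⟩⟩
  rw [Metric.mem_ball, Real.dist_eq, sub_zero, abs_of_nonneg ht.1]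
  exact (ht.2.trans (min_le_left _ _)).trans_lt (half_lt_self hε)

end Perron

namespace Perron

theorem IsContour.norm_integral_comp_mul_deriv_le {c : ℝ → ℂ} (hc : IsContour c) {a b : ℝ}
    (ha : 0 ≤ a) (hab : a ≤ b) (hb : b ≤ 1) {f : ℂ → ℂ} {D : ℝ}
    (hD : ∀ t ∈ Icc a b, ‖f (c t)‖ ≤ D) :
    ‖∫ t in a..b, f (c t) * deriv c t‖ ≤ D * ∫ t in a..b, ‖deriv c t‖ := by
  have hi : IntervalIntegrable (deriv c) volume a b := by
    refine hc.finite_length.mono_set ?_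
    rw [uIcc_of_le hab, uIcc_of_le zero_le_one]
    exact Icc_subset_Icc ha hb
  rw [← intervalIntegral.integral_const_mul]
  refine intervalIntegral.norm_integral_le_of_norm_le hab (ae_of_all _ fun t ht => ?_)
    (hi.norm.const_mul D)
  rw [norm_mul]
  exact mul_le_mul_of_nonneg_right (hD t (Ioc_subset_Icc_self ht)) (norm_nonneg _)

/-- On a final part of the contour, the real part of `p` stays away from its maximum. -/
theorem IsContour.exists_re_le_sub {c : ℝ → ℂ} (hc : IsContour c) {p : ℂ → ℂ} {z₀ : ℂ}
    (hp : ∀ z ∈ trace c, DifferentiableAt ℂ p z)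
    (hmax : ∀ z ∈ trace c, z ≠ z₀ → (p z).re < (p z₀).re)
    (hstart : ∀ t : ℝ, 0 < t → t ≤ 1 → c t ≠ z₀) {τ : ℝ} (hτ : 0 < τ) (hτ1 : τ ≤ 1) :
    ∃ ε > 0, ∀ t ∈ Icc τ 1, (p (c t)).re ≤ (p z₀).re - ε := by
  have hsub : Icc τ 1 ⊆ Icc 0 1 := Icc_subset_Icc_left hτ.le
  have hcont : ContinuousOn (fun t => (p (c t)).re) (Icc τ 1) := fun t ht =>
    continuous_re.continuousAt.comp_continuousWithinAt
      ((hp _ (mem_image_of_mem c (hsub ht))).continuousAt.comp_continuousWithinAt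
        ((hc.continuousOn.mono hsub) t ht))
  obtain ⟨t₁, ht₁, h⟩ := isCompact_Icc.exists_isMaxOn ⟨1, hτ1, le_rfl⟩ hcont
  refine ⟨(p z₀).re - (p (c t₁)).re, sub_pos.2 (hmax _ (mem_image_of_mem c (hsub ht₁))
    (hstart t₁ (hτ.trans_le ht₁.1) ht₁.2)), fun t ht => ?_⟩
  rw [sub_sub_cancel]
  exact h ht

theorem analyticAt_localFactor {p₀ : ℂ} {μ : ℕ} {k : ℤ} {φ : ℂ → ℂ} {z : ℂ}
    (hφ : AnalyticAt ℂ φ z) (hz : 0 < (1 - φ z).re) :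
    AnalyticAt ℂ (localFactor p₀ μ k φ) z :=
  ((analyticAt_const.sub hφ).cpow analyticAt_const (Or.inl hz)).mul analyticAt_const

/-- The contribution of an initial part of the contour. -/
theorem exists_norm_initial_integral_sub_le {c : ℝ → ℂ} {z₀ : ℂ} (hc : IsContour c)
    (hc0 : c 0 = z₀) {B : Set ℂ} (hB : B ∈ 𝓝 z₀) {p : ℂ → ℂ}
    (hp : ∀ z ∈ B, DifferentiableAt ℂ p z) {μ : ℕ} (hμ : 1 ≤ μ) {p₀ : ℂ} (hp₀ : p₀ ≠ 0)
    {φ : ℂ → ℂ} (hφ : DifferentiableOn ℂ φ B) (hφ0 : φ z₀ = 0)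
    (hpφ : ∀ z ∈ B, p z = p z₀ - p₀ * (z - z₀) ^ μ * (1 - φ z))
    (hmax : ∀ z ∈ trace c, z ≠ z₀ → (p z).re < (p z₀).re)
    (hstart : ∀ t : ℝ, 0 < t → t ≤ 1 → c t ≠ z₀) {k : ℤ} (hk : StartsInSector c z₀ p₀ μ k)
    (S : ℕ) :
    ∃ τ : ℝ, 0 < τ ∧ τ ≤ 1 ∧ ∃ A N₀ : ℝ, 0 < N₀ ∧
      ∀ q : ℂ → ℂ, (∀ z ∈ B, DifferentiableAt ℂ q z) → ∀ Kq : ℝ, (∀ z ∈ B, ‖q z‖ ≤ Kq) →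
        ∀ N : ℝ, N₀ ≤ N →
          IntervalIntegrable (fun t => exp ((N : ℂ) * p (c t)) * q (c t) * deriv c t)
            volume 0 τ ∧
          ∃ R : ℂ, ‖R‖ ≤ A * (Kq / N ^ (((S : ℝ) + 1) / (μ : ℝ))) ∧
            ∫ t in (0 : ℝ)..τ, exp ((N : ℂ) * p (c t)) * q (c t) * deriv c t =
              exp ((N : ℂ) * p z₀) *
                ((∑ s ∈ Finset.range S,
                  (Real.Gamma (((s : ℝ) + 1) / (μ : ℝ)) : ℂ) *
                    (coeff z₀ p₀ μ φ q s *
                      exp (2 * (Real.pi : ℂ) * I * (k : ℂ) * ((s : ℂ) + 1) / (μ : ℂ))) /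
                    ((N ^ (((s : ℝ) + 1) / (μ : ℝ)) : ℝ) : ℂ)) + R) := by
  obtain ⟨δ, hδ, hsec⟩ := hk
  have hφa : AnalyticAt ℂ φ z₀ := hφ.analyticAt hB
  have hφre : ∀ᶠ z in 𝓝 z₀, 0 < (1 - φ z).re := by
    have : ContinuousAt (fun z => (1 - φ z).re) z₀ :=
      continuous_re.continuousAt.comp (continuousAt_const.sub hφa.continuousAt)
    exact this.eventually_const_lt (by simp [hφ0])
  set U := localFactor p₀ μ k φ with hU
  set W : ℂ → ℂ := fun z => (z - z₀) * U z with hW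
  have hUa : AnalyticAt ℂ U z₀ := analyticAt_localFactor hφa hφre.self_of_nhds
  have hU0 : U z₀ ≠ 0 := by
    rw [hU, localFactor, hφ0, sub_zero, one_cpow, one_mul]
    exact inv_ne_zero (invRoot_ne_zero hp₀ μ k)
  have hWa : AnalyticAt ℂ W z₀ := (analyticAt_id.sub analyticAt_const).mul hUa
  have hW0 : W z₀ = 0 := by simp [hW]
  have hW' : deriv W z₀ ≠ 0 := by
    have : HasDerivAt W (1 * U z₀ + (z₀ - z₀) * deriv U z₀) z₀ :=
      ((hasDerivAt_id' z₀).sub_const z₀).fun_mul hUa.differentiableAt.hasDerivAt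
    rw [this.deriv]
    simpa using hU0
  have hWpow : ∀ z ∈ B, W z ^ μ = p z₀ - p z := fun z hz => by
    rw [hW, hU, mul_localFactor_pow hμ, hpφ z hz]
    ring
  obtain ⟨ρ, hρ, m, hm, ψ, hψd, hψ, hψW⟩ := exists_local_left_inverse hWa hW0 hW' hB
  obtain ⟨τ₀, hτ₀, hτ₀1, hgood⟩ := hc.exists_initial (P := fun z =>
    (((z ∈ B ∧ 0 < (1 - φ z).re) ∧ AnalyticAt ℂ W z) ∧ deriv W z ≠ 0) ∧
      W z ∈ Metric.ball 0 ρ ∧ ψ (W z) = z) (by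
    rw [hc0]
    exact ((((show ∀ᶠ z in 𝓝 z₀, z ∈ B from hB).and hφre).and hWa.eventually_analyticAt).and
      (hWa.deriv.continuousAt.eventually_ne hW')).and hψW)
  set τ : ℝ := min τ₀ (δ / 2) with hτdef
  have hτ : 0 < τ := by positivity
  have hττ₀ : τ ≤ τ₀ := min_le_left _ _
  have hτ1 : τ ≤ 1 := hττ₀.trans hτ₀1
  have hτδ : τ < δ := (min_le_right _ _).trans_lt (half_lt_self hδ)
  have hmemτ : τ ∈ Icc 0 τ₀ := ⟨hτ.le, hττ₀⟩
  obtain ⟨⟨⟨⟨hτB, hτφ⟩, -⟩, -⟩, hτball, -⟩ := hgood τ hmemτ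
  have hre : 0 < (p₀ * (c τ - z₀) ^ μ * (1 - φ (c τ))).re := by
    have := hmax (c τ) (mem_image_of_mem c ⟨hτ.le, hτ1⟩) (hstart τ hτ hτ1)
    rw [hpφ _ hτB, sub_re] at this
    linarith
  obtain ⟨r, α, hr, hα, hpolar⟩ :=
    exists_polar_of_mem_sector hμ hp₀ (hsec τ hτ hτδ) hτφ hre
  have hWτ : W (c τ) = r * exp (α * I) := hpolar
  have hrρ : r < ρ := by
    rwa [hWτ, mem_ball_zero_iff, norm_mul, norm_exp_ofReal_mul_I, mul_one, norm_real,
      Real.norm_of_nonneg hr.le] at hτball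
  obtain ⟨C, N₀, hN₀, hprim⟩ := exists_norm_primitive_sub_le hμ S hr hrρ hα
  refine ⟨τ, hτ, hτ1, C / m, N₀, hN₀, fun q hq Kq hKq N hN => ?_⟩
  have hmB : ∀ t ∈ Icc 0 τ, c t ∈ B := fun t ht =>
    (hgood t ⟨ht.1, ht.2.trans hττ₀⟩).1.1.1.1
  have hcont : ContinuousOn (fun t => exp ((N : ℂ) * p (c t)) * q (c t)) (Icc 0 τ) := by
    have hcc : ContinuousOn c (Icc 0 τ) := hc.continuousOn.mono (Icc_subset_Icc_right hτ1)
    intro t ht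
    have hpc := (hp _ (hmB t ht)).continuousAt.comp_continuousWithinAt (hcc t ht)
    have hqc := (hq _ (hmB t ht)).continuousAt.comp_continuousWithinAt (hcc t ht)
    exact (continuousWithinAt_const.mul hpc).cexp.mul hqc
  refine ⟨hc.intervalIntegrable_comp_mul_deriv le_rfl hτ.le hτ1
    (f := fun z => exp ((N : ℂ) * p z) * q z) hcont, ?_⟩
  set g : ℂ → ℂ := fun v => q (ψ v) / deriv W (ψ v) with hg
  have hgd : DifferentiableOn ℂ g (Metric.ball 0 ρ) := fun v hv => by
    obtain ⟨hvB, hvW, hvm⟩ := hψ v hv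
    have hψv : DifferentiableAt ℂ ψ v := hψd.differentiableAt (Metric.isOpen_ball.mem_nhds hv)
    exact (((hq _ hvB).comp v hψv).div (hvW.deriv.differentiableAt.comp v hψv)
      (norm_pos_iff.1 (hm.trans_le hvm))).differentiableWithinAt
  have hgM : ∀ v ∈ Metric.ball (0 : ℂ) ρ, ‖g v‖ ≤ Kq / m := fun v hv => by
    obtain ⟨hvB, -, hvm⟩ := hψ v hv
    rw [hg, norm_div]
    exact div_le_div₀ ((norm_nonneg _).trans (hKq _ hvB)) (hKq _ hvB) hm hvm
  have hgq : ∀ z, deriv W z ≠ 0 → ψ (W z) = z → g (W z) * deriv W z = q z := fun z h1 h2 => by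
    rw [hg]
    simp only [h2]
    exact div_mul_cancel₀ _ h1
  obtain ⟨H, hH⟩ : IsExactOn (fun v => exp (-(N : ℂ) * v ^ μ) * g v) (Metric.ball 0 ρ) :=
    ((Differentiable.differentiableOn (by fun_prop)).mul hgd).isExactOn_ball
  have hest := hprim g (Kq / m) hgd hgM N hN H hH
  have hftc := hc.integral_deriv_comp le_rfl hτ.le hτ1
    (F := fun z => exp ((N : ℂ) * p z₀) * H (W z)) (f := fun z => exp ((N : ℂ) * p z) * q z)
    (fun t ht => by
      obtain ⟨⟨⟨⟨htB, -⟩, htW⟩, ht'⟩, htball, htψ⟩ := hgood t ⟨ht.1, ht.2.trans hττ₀⟩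
      refine (((hH _ htball).comp (c t) htW.differentiableAt.hasDerivAt).const_mul
        (exp ((N : ℂ) * p z₀))).congr_deriv ?_
      rw [mul_assoc, hgq _ ht' htψ, ← mul_assoc, ← exp_add, hWpow _ htB]
      congr 2
      ring) hcont
  rw [hftc, hc0, hW0, hWτ, ← mul_sub]
  refine ⟨_, hest.trans (le_of_eq (by ring)), ?_⟩
  rw [add_comm, sub_add_eq_add_sub]
  congr 1
  rw [eq_sub_iff_add_eq]
  congr 1
  refine Finset.sum_congr rfl fun s _ => ?_
  have hlag := iteratedDeriv_mul_inv_pow_of_expansion (z₀ := z₀) (U := U) (q := q)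
    (k := fun z => (fun f => dslope f 0)^[s + 1] g (W z) * deriv W z)
    (a := fun j => (fun f => dslope f 0)^[j] g 0) (s := s) hUa hU0
    (DifferentiableOn.analyticAt (fun z hz => (hq z hz).differentiableWithinAt) hB)
    (by
      have hd := (iterate_dslope_spec hρ hgd hgM (s + 1)).1
      exact ((hd.analyticAt (Metric.ball_mem_nhds 0 hρ)).comp_of_eq hWa hW0).mul hWa.deriv)
    (by
      filter_upwards [hψW, hWa.deriv.continuousAt.eventually_ne hW'] with z hz hz'
      rw [← hgq z hz' hz.2, (iterate_dslope_spec hρ hgd hgM (s + 1)).2.2 (W z), add_mul,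
        mul_assoc (W z ^ (s + 1))])
  have hfac : (s.factorial : ℂ) ≠ 0 := Nat.cast_ne_zero.2 s.factorial_ne_zero
  rw [coeff_mul_exp, ← hU, hlag]
  push_cast
  field_simp

end Perron

theorem theorem1p2
    -- the contour, from `z₀` to `z₁`
    (c : ℝ → ℂ) (z₀ z₁ : ℂ) (hc : Perron.IsContour c) (hc0 : c 0 = z₀) (hc1 : c 1 = z₁)
    (hz : z₀ ≠ z₁)
    -- the neighborhood `B` of `z₀`, and the function `p` with its expansion at `z₀`
    (B : Set ℂ) (hB : B ∈ 𝓝 z₀)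
    (p : ℂ → ℂ) (hp : Perron.HolomorphicOnDomainContaining p (B ∪ Perron.trace c))
    (μ : ℕ) (hμ : 1 ≤ μ) (p₀ : ℂ) (hp₀ : p₀ ≠ 0)
    (φ : ℂ → ℂ) (hφ : DifferentiableOn ℂ φ B) (hφ0 : φ z₀ = 0)
    (hpφ : ∀ z ∈ B, p z = p z₀ - p₀ * (z - z₀) ^ μ * (1 - φ z))
    -- the real part of `p` has its strict maximum on the contour at `z₀`
    (hmax : ∀ z ∈ Perron.trace c, z ≠ z₀ → (p z).re < (p z₀).re)
    -- the contour does not come back to its starting point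
    (hstart : ∀ t : ℝ, 0 < t → t ≤ 1 → c t ≠ z₀) :
    (∃ k : ℤ, Perron.StartsInSector c z₀ p₀ μ k) ∧
    ∀ k : ℤ, Perron.StartsInSector c z₀ p₀ μ k → ∀ S : ℕ,
      ∃ A N₀ : ℝ, 0 < N₀ ∧
        ∀ q : ℂ → ℂ, Perron.HolomorphicOnDomainContaining q (B ∪ Perron.trace c) →
          ∀ Kq : ℝ, (∀ z ∈ B ∪ Perron.trace c, ‖q z‖ ≤ Kq) →
            ∀ N : ℝ, N₀ ≤ N →
              ∃ R : ℂ, ‖R‖ ≤ A * (Kq / N ^ (((S : ℝ) + 1) / (μ : ℝ))) ∧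
                Perron.contourIntegral c (fun z => exp ((N : ℂ) * p z) * q z) =
                  exp ((N : ℂ) * p z₀) *
                    ((∑ s ∈ Finset.range S,
                      (Real.Gamma (((s : ℝ) + 1) / (μ : ℝ)) : ℂ) *
                        (Perron.coeff z₀ p₀ μ φ q s *
                          exp (2 * (Real.pi : ℂ) * I * (k : ℂ) * ((s : ℂ) + 1) / (μ : ℂ))) /
                        ((N ^ (((s : ℝ) + 1) / (μ : ℝ)) : ℝ) : ℂ)) + R) := by
  have hpd : ∀ z ∈ B ∪ Perron.trace c, DifferentiableAt ℂ p z := by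
    obtain ⟨V, hV, -, hsub, hd⟩ := hp
    exact fun z hz => hd.differentiableAt (hV.mem_nhds (hsub hz))
  have htrace : ∀ t : ℝ, 0 ≤ t → t ≤ 1 → c t ∈ Perron.trace c := fun t h0 h1 =>
    mem_image_of_mem c ⟨h0, h1⟩
  constructor
  · have hφre : ∀ᶠ z in 𝓝 (c 0), z ∈ B ∧ 0 < (1 - φ z).re := by
      rw [hc0]
      have : ContinuousAt (fun z => (1 - φ z).re) z₀ := continuous_re.continuousAt.comp
        (continuousAt_const.sub (hφ.analyticAt hB).continuousAt)
      exact (show ∀ᶠ z in 𝓝 z₀, z ∈ B from hB).and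
        (this.eventually_const_lt (by simp [hφ0]))
    obtain ⟨τ, hτ, hτ1, hgood⟩ := hc.exists_initial hφre
    refine Perron.exists_startsInSector hμ hp₀ hτ (hc.continuousOn.mono
      (Ioo_subset_Icc_self.trans (Icc_subset_Icc_right hτ1))) fun t ht => ?_
    obtain ⟨htB, htφ⟩ := hgood t (Ioo_subset_Icc_self ht)
    have ht1 := ht.2.le.trans hτ1
    have := hmax (c t) (htrace t ht.1.le ht1) (hstart t ht.1 ht1)
    rw [hpφ _ htB, sub_re] at this
    exact mem_slitPlane_of_re_mul_pos htφ (by linarith)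
  · intro k hk S
    obtain ⟨τ, hτ, hτ1, A, N₁, hN₁, hnear⟩ := Perron.exists_norm_initial_integral_sub_le hc hc0 hB
      (fun z hz => hpd z (Or.inl hz)) hμ hp₀ hφ hφ0 hpφ hmax hstart hk S
    obtain ⟨ε, hε, hfar⟩ := hc.exists_re_le_sub (fun z hz => hpd z (Or.inr hz)) hmax hstart hτ hτ1
    obtain ⟨N₂, -, hexp⟩ := exists_exp_neg_mul_le_one_div_rpow (((S : ℝ) + 1) / μ) hε
    set L : ℝ := ∫ t in τ..1, ‖deriv c t‖ with hL
    have hL0 : 0 ≤ L := intervalIntegral.integral_nonneg hτ1 fun t _ => norm_nonneg _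
    refine ⟨A + L, max N₁ N₂, hN₁.trans_le (le_max_left _ _), fun q hq Kq hKq N hN => ?_⟩
    have hqd : ∀ z ∈ B ∪ Perron.trace c, DifferentiableAt ℂ q z := by
      obtain ⟨V, hV, -, hsub, hd⟩ := hq
      exact fun z hz => hd.differentiableAt (hV.mem_nhds (hsub hz))
    have hN1 : N₁ ≤ N := (le_max_left _ _).trans hN
    have hN0 : 0 < N := hN₁.trans_le hN1
    have hKq0 : 0 ≤ Kq := (norm_nonneg _).trans (hKq z₀ (Or.inl (mem_of_mem_nhds hB)))
    obtain ⟨hint, R, hR, heq⟩ := hnear q (fun z hz => hqd z (Or.inl hz)) Kq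
      (fun z hz => hKq z (Or.inl hz)) N hN1
    set T : ℂ := ∫ t in τ..1, exp ((N : ℂ) * p (c t)) * q (c t) * deriv c t with hT
    have hint' : IntervalIntegrable (fun t => exp ((N : ℂ) * p (c t)) * q (c t) * deriv c t)
        volume τ 1 := by
      refine hc.intervalIntegrable_comp_mul_deriv hτ.le hτ1 le_rfl
        (f := fun z => exp ((N : ℂ) * p z) * q z) fun t ht => ?_
      have htr : c t ∈ B ∪ Perron.trace c := Or.inr (htrace t (hτ.le.trans ht.1) ht.2)
      have hct := (hc.continuousOn.mono (Icc_subset_Icc_left hτ.le)) t ht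
      exact (continuousWithinAt_const.mul
        ((hpd _ htr).continuousAt.comp_continuousWithinAt hct)).cexp.mul
          ((hqd _ htr).continuousAt.comp_continuousWithinAt hct)
    have hTle : ‖T‖ ≤ ‖exp ((N : ℂ) * p z₀)‖ * (Real.exp (-ε * N) * Kq) * L := by
      refine hc.norm_integral_comp_mul_deriv_le hτ.le hτ1 le_rfl
        (f := fun z => exp ((N : ℂ) * p z) * q z) fun t ht => ?_
      rw [norm_mul, norm_exp, norm_exp, ← mul_assoc, ← Real.exp_add, re_ofReal_mul,
        re_ofReal_mul]
      refine mul_le_mul (Real.exp_le_exp.2 ?_)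
        (hKq _ (Or.inr (htrace t (hτ.le.trans ht.1) ht.2))) (norm_nonneg _) (Real.exp_pos _).le
      have := mul_le_mul_of_nonneg_left (hfar t ht) hN0.le
      linarith
    refine ⟨R + T / exp ((N : ℂ) * p z₀), ?_, ?_⟩
    · have hTR : ‖T / exp ((N : ℂ) * p z₀)‖ ≤ L * (Kq / N ^ (((S : ℝ) + 1) / (μ : ℝ))) := by
        rw [norm_div, div_le_iff₀ (norm_pos_iff.2 (exp_ne_zero _))]
        calc ‖T‖ ≤ ‖exp ((N : ℂ) * p z₀)‖ * (Real.exp (-ε * N) * Kq) * L := hTle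
          _ ≤ ‖exp ((N : ℂ) * p z₀)‖ * (1 / N ^ (((S : ℝ) + 1) / (μ : ℝ)) * Kq) * L := by
            gcongr
            exact hexp N ((le_max_right _ _).trans hN)
          _ = _ := by ring
      rw [add_mul]
      exact (norm_add_le _ _).trans (add_le_add hR hTR)
    · rw [Perron.contourIntegral, ← intervalIntegral.integral_add_adjacent_intervals hint hint',
        heq, ← hT, ← add_assoc, mul_add _ _ (T / _), mul_div_cancel₀ _ (exp_ne_zero _)]
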